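/- Let $\mathcal A$ be a unital C$^*$-algebra, and let $\mathcal A^{**}$ denote its enveloping von Neumann algebra, i.e. the double commutant of $\mathcal A$ in its universal representation (the Hilbert sum of the GNS representations of all states), which is the standard realization of the second dual; $\mathcal A$ is regarded as a subalgebra of $\mathcal A^{**}$. On $\mathcal A^2$ let $\theta(\mathbf x,\mathbf y)=x_1^*y_1-x_2^*y_2$, and let $\mathcal U(\theta)$ be the group of all invertible $2\times 2$ matrices $g=\begin{pmatrix} g_{11}&g_{12}\\ g_{21}&g_{22}\end{pmatrix}$ over $\mathcal A$ such that $\theta(g\mathbf x,g\mathbf y)=\theta(\mathbf x,\mathbf y)$ for all $\mathbf x,\mathbf y\in\mathcal A^2$ (where $g$ acts by left multiplication on columns). Put $\partial\mathcal D=\{a\in\mathcal A^{**}:\|a\|=1\}$. Then for all $g\in\mathcal U(\theta)$ and $a\in\partial\mathcal D$ the element $g_{11}+g_{12}a$ is invertible in $\mathcal A^{**}$ and $$g\cdot a:=(g_{21}+g_{22}a)(g_{11}+g_{12}a)^{-1}\in\partial\mathcal D .$$ Moreover, this formula defines a left action of the group $\mathcal U(\theta)$ on $\partial\mathcal D$: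 $1\cdot a=a$ and $(gh)\cdot a=g\cdot(h\cdot a)$ for all $g,h\in\mathcal U(\theta)$, $a\in\partial\mathcal D$. -/

import Mathlib

open scoped ComplexOrder InnerProductSpace

noncomputable section

namespace PoincareDisk

universe u

/-! ### Hilbert sums of representations -/

section HilbertSum

variable {A : Type*} [CStarAlgebra A] {ι : Type*} {G : ι → Type*}
  [∀ i, NormedAddCommGroup (G i)] [∀ i, InnerProductSpace ℂ (G i)] [∀ i, CompleteSpace (G i)]

theorem norm_rep_apply_le {K : Type*} [NormedAddCommGroup K] [InnerProductSpace ℂ K]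
    [CompleteSpace K] (π : A →⋆ₐ[ℂ] (K →L[ℂ] K)) (a : A) (v : K) :
    ‖π a v‖ ≤ ‖a‖ * ‖v‖ :=
  ((π a).le_opNorm v).trans
    (mul_le_mul_of_nonneg_right (NonUnitalStarAlgHom.norm_apply_le π a) (norm_nonneg v))

theorem norm_rep_apply_le' (π : ∀ i, A →⋆ₐ[ℂ] (G i →L[ℂ] G i)) (a : A) (x : lp G 2) (i : ι) :
    ‖π i a (x i)‖ ≤ ‖(((‖a‖ : ℝ) : ℂ) • x : lp G 2) i‖ := by
  rw [lp.coeFn_smul, Pi.smul_apply, norm_smul, Complex.norm_real, norm_norm]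
  exact norm_rep_apply_le (π i) a (x i)

/-- The operator `(xᵢ)ᵢ ↦ (πᵢ(a) xᵢ)ᵢ` on the Hilbert sum of the spaces `G i`. -/
def hilbertSumOp (π : ∀ i, A →⋆ₐ[ℂ] (G i →L[ℂ] G i)) (a : A) : lp G 2 →L[ℂ] lp G 2 :=
  LinearMap.mkContinuous
    { toFun := fun x => ⟨fun i => π i a (x i),
        (lp.memℓp (((‖a‖ : ℝ) : ℂ) • x : lp G 2)).mono' (norm_rep_apply_le' π a x)⟩
      map_add' := fun x y => by
        ext i
        exact map_add (π i a) (x i) (y i)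
      map_smul' := fun c x => by
        ext i
        exact map_smul (π i a) c (x i) }
    ‖a‖ fun x => by
      refine (lp.norm_mono two_ne_zero (norm_rep_apply_le' π a x)).trans ?_
      rw [norm_smul, Complex.norm_real, norm_norm]

@[simp]
theorem hilbertSumOp_apply (π : ∀ i, A →⋆ₐ[ℂ] (G i →L[ℂ] G i)) (a : A) (x : lp G 2) (i : ι) :
    hilbertSumOp π a x i = π i a (x i) := rfl

/-- The Hilbert sum `⊕ᵢ πᵢ` of a family of representations of a C⋆-algebra. -/
def hilbertSum (π : ∀ i, A →⋆ₐ[ℂ] (G i →L[ℂ] G i)) : A →⋆ₐ[ℂ] (lp G 2 →L[ℂ] lp G 2) where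
  toFun := hilbertSumOp π
  map_one' := by
    ext x i
    simp
  map_mul' a b := by
    ext x i
    simp
  map_zero' := by
    ext x i
    simp
  map_add' a b := by
    ext x i
    simp
  commutes' r := by
    ext x i
    simp [Algebra.algebraMap_eq_smul_one]
  map_star' a := by
    refine (ContinuousLinearMap.eq_adjoint_iff _ _).mpr fun x y => ?_
    rw [lp.inner_eq_tsum, lp.inner_eq_tsum]
    refine tsum_congr fun i => ?_
    rw [hilbertSumOp_apply, hilbertSumOp_apply, map_star, ContinuousLinearMap.star_eq_adjoint,
      ContinuousLinearMap.adjoint_inner_left]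

end HilbertSum

/-! ### The enveloping von Neumann algebra `A**` -/

section Enveloping

variable (A : Type u) [CStarAlgebra A] [PartialOrder A] [StarOrderedRing A]

/-- The states of a unital C⋆-algebra: positive linear functionals with `φ(1) = 1`. -/
def State : Type u := {φ : A →ₚ[ℂ] ℂ // φ 1 = 1}

/-- The Hilbert space of the universal representation: the Hilbert sum, over all states, of the
corresponding GNS spaces. -/
abbrev UniversalSpace : Type u := lp (fun φ : State A => φ.1.GNS) 2

/-- The universal representation: the Hilbert sum of the GNS representations of all states. -/
def universalRep : A →⋆ₐ[ℂ] (UniversalSpace A →L[ℂ] UniversalSpace A) :=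
  hilbertSum fun φ : State A => φ.1.gnsStarAlgHom

/-- The enveloping von Neumann algebra of `A`: the double commutant of the image of `A` in its
universal representation. -/
def envelopingVonNeumannAlgebra : VonNeumannAlgebra (UniversalSpace A) where
  toStarSubalgebra := StarSubalgebra.centralizer ℂ
    (StarSubalgebra.centralizer ℂ
      (Set.range (universalRep A)) : Set (UniversalSpace A →L[ℂ] UniversalSpace A))
  centralizer_centralizer' := by
    have h := StarSubalgebra.coe_centralizer_centralizer ℂ (Set.range (universalRep A))
    refine (congrArg (fun s => Set.centralizer (Set.centralizer s)) h).trans (Eq.trans ?_ h.symm)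
    exact Set.centralizer_centralizer_centralizer _

/-- `A**` as a unital ⋆-algebra, with the operator norm. -/
abbrev Bidual : Type u := (envelopingVonNeumannAlgebra A).toStarSubalgebra

/-- The canonical unital ⋆-homomorphism `A → A**`. -/
def toBidual : A →⋆ₐ[ℂ] Bidual A :=
  (universalRep A).codRestrict _ fun a => by
    have h := StarSubalgebra.coe_centralizer_centralizer ℂ (Set.range (universalRep A))
    exact h.ge (Set.subset_centralizer_centralizer (Or.inl ⟨a, rfl⟩))

/-- The strong border `∂D = {a ∈ A** : ‖a‖ = 1}` of the unit disk of `A`. -/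
def border : Set (Bidual A) := {a | ‖a‖ = 1}

end Enveloping

/-! ### The unitary group of the form `θ` -/

section Theta

variable {A : Type u} [CStarAlgebra A]

/-- The form `θ(x, y) = x₁* y₁ - x₂* y₂` on `A²` (the two coordinates have indices `0` and `1`). -/
def theta (x y : Fin 2 → A) : A := star (x 0) * y 0 - star (x 1) * y 1

open Matrix in
/-- The group `U(θ)` of the invertible `2 × 2` matrices over `A` that, acting on `A²` by left
multiplication, preserve `θ`. -/
def unitaryTheta (A : Type u) [CStarAlgebra A] : Subgroup (Matrix (Fin 2) (Fin 2) A)ˣ where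
  carrier := {g | ∀ x y : Fin 2 → A, theta (g.1 *ᵥ x) (g.1 *ᵥ y) = theta x y}
  one_mem' x y := by simp
  mul_mem' {g h} hg hh x y := by
    rw [Units.val_mul, ← Matrix.mulVec_mulVec, ← Matrix.mulVec_mulVec]
    exact (hg _ _).trans (hh x y)
  inv_mem' {g} hg x y := by
    have := hg ((g⁻¹).1 *ᵥ x) ((g⁻¹).1 *ᵥ y)
    rw [Matrix.mulVec_mulVec, Matrix.mulVec_mulVec, Units.mul_inv, Matrix.one_mulVec,
      Matrix.one_mulVec] at this
    exact this.symm

variable [PartialOrder A] [StarOrderedRing A]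

/-- `g₂₁ + g₂₂ a` in `A**`. -/
def mobiusNum (g : unitaryTheta A) (a : Bidual A) : Bidual A :=
  toBidual A (g.1.1 1 0) + toBidual A (g.1.1 1 1) * a

/-- `g₁₁ + g₁₂ a` in `A**`. -/
def mobiusDen (g : unitaryTheta A) (a : Bidual A) : Bidual A :=
  toBidual A (g.1.1 0 0) + toBidual A (g.1.1 0 1) * a

end Theta

end PoincareDisk

end

open PoincareDisk

/-! ### Norm and invertibility in a C⋆-algebra -/

section CStar

variable {B : Type*} [CStarAlgebra B]

/-! With `J = diag(1, -1)`, preserving `θ` means `g*Jg = J`; since `g` is invertible, also `gJg* =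
J`. The corner entries of both make `g₁₁*g₁₁` and `g₁₁g₁₁*` invertible, so `g₁₁` is, and give
`‖g₁₁⁻¹g₁₂‖ < 1`; a Neumann series then inverts the denominator `D`. With numerator `N`, applying
`θ` to `g(1, a)` gives `D*D - N*N = 1 - a*a`. Conjugating by `D⁻¹` preserves positivity and
non-invertibility, and `‖a‖ = 1` says exactly that `1 - a*a` is positive and not invertible
(`norm_mul_inv_eq_one`). The action law is matrix multiplication on columns `(1, a)` up to right
factors. -/

theorem isUnit_one_add_star_mul_self (x : B) : IsUnit (1 + star x * x) := by
  let _ := CStarAlgebra.spectralOrder B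
  let _ := CStarAlgebra.spectralOrderedRing B
  exact (isStrictlyPositive_one.add_nonneg (star_mul_self_nonneg x)).isUnit

/-- The norm of the positive element `a*a`, here `1`, lies in its spectrum. -/
theorem not_isUnit_one_sub_star_mul_self {a : B} (ha : ‖a‖ = 1) :
    ¬ IsUnit (1 - star a * a) := by
  let _ := CStarAlgebra.spectralOrder B
  let _ := CStarAlgebra.spectralOrderedRing B
  have : Nontrivial B := ⟨a, 0, fun h => by simp [h] at ha⟩
  have h := CStarAlgebra.norm_mem_spectrum_of_nonneg (star_mul_self_nonneg a)
  rw [CStarRing.norm_star_mul_self, ha, mul_one, spectrum.mem_iff, map_one] at h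
  exact h

theorem isUnit_one_sub_star_mul_self {a : B} (ha : ‖a‖ < 1) : IsUnit (1 - star a * a) := by
  refine isUnit_one_sub_of_norm_lt_one ?_
  rw [CStarRing.norm_star_mul_self]
  nlinarith [norm_nonneg a]

theorem norm_le_one_of_one_sub_star_mul_self_eq {a u : B} (h : 1 - star a * a = star u * u) :
    ‖a‖ ≤ 1 := by
  let _ := CStarAlgebra.spectralOrder B
  let _ := CStarAlgebra.spectralOrderedRing B
  have h1 : star a * a ≤ 1 := sub_nonneg.mp (h ▸ star_mul_self_nonneg u)
  have h2 := (CStarAlgebra.norm_le_one_iff_of_nonneg _ (star_mul_self_nonneg a)).mpr h1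
  rw [CStarRing.norm_star_mul_self] at h2
  nlinarith [norm_nonneg a]

theorem norm_lt_one_of_one_sub_star_mul_self_eq {a u : B} (hu : IsUnit u)
    (h : 1 - star a * a = star u * u) : ‖a‖ < 1 :=
  (norm_le_one_of_one_sub_star_mul_self_eq h).lt_of_ne fun h1 =>
    not_isUnit_one_sub_star_mul_self h1 (h ▸ hu.star.mul hu)

theorem exists_one_sub_star_mul_self_eq {a : B} (ha : ‖a‖ ≤ 1) :
    ∃ s : B, 1 - star a * a = star s * s := by
  let _ := CStarAlgebra.spectralOrder B
  let _ := CStarAlgebra.spectralOrderedRing B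
  have h1 : star a * a ≤ 1 := by
    refine (CStarAlgebra.norm_le_one_iff_of_nonneg _ (star_mul_self_nonneg a)).mp ?_
    rw [CStarRing.norm_star_mul_self]
    nlinarith [norm_nonneg a]
  exact CStarAlgebra.nonneg_iff_eq_star_mul_self.mp (sub_nonneg.mpr h1)

/-- If `D` is invertible and `D*D - N*N = 1 - a*a`, then `‖ND⁻¹‖ = 1` as soon as `‖a‖ = 1`. -/
theorem norm_mul_inv_eq_one {a N : B} (D : Bˣ)
    (h : star (D : B) * D - star N * N = 1 - star a * a) (ha : ‖a‖ = 1) :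
    ‖N * (↑D⁻¹ : B)‖ = 1 := by
  have e1 : (D : B) * (↑D⁻¹ : B) = 1 := D.mul_inv
  have e2 : star (↑D⁻¹ : B) * star (D : B) = 1 := by rw [← star_mul, e1, star_one]
  have e3 : (↑D⁻¹ : B) * (D : B) = 1 := D.inv_mul
  have key : 1 - star (N * (↑D⁻¹ : B)) * (N * (↑D⁻¹ : B)) =
      star (↑D⁻¹ : B) * (1 - star a * a) * (↑D⁻¹ : B) := by
    rw [← h, star_mul]
    calc 1 - star (↑D⁻¹ : B) * star N * (N * (↑D⁻¹ : B))
        = (star (↑D⁻¹ : B) * star (D : B)) * ((D : B) * (↑D⁻¹ : B))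
            - star (↑D⁻¹ : B) * star N * (N * (↑D⁻¹ : B)) := by rw [e1, e2, one_mul]
      _ = _ := by noncomm_ring
  obtain ⟨s, hs⟩ := exists_one_sub_star_mul_self_eq ha.le
  refine (norm_le_one_of_one_sub_star_mul_self_eq (u := s * (↑D⁻¹ : B)) ?_).eq_of_not_lt ?_
  · rw [key, hs, star_mul]
    simp only [mul_assoc]
  -- Norm below `1` would make the left side of `key` invertible; cancelling the outer units, so
  -- would be `1 - a*a`.
  · intro hlt
    have hu := isUnit_one_sub_star_mul_self hlt
    rw [key, Units.isUnit_mul_units] at hu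
    rw [show star (↑D⁻¹ : B) = ((star D⁻¹ : Bˣ) : B) from rfl, Units.isUnit_units_mul] at hu
    exact not_isUnit_one_sub_star_mul_self ha hu

/-- If `p` is invertible and `pp* - qq* = 1`, then `‖p⁻¹q‖ < 1`. -/
theorem exists_eq_mul_norm_lt_one {p q : B} (hp : IsUnit p) (h : p * star p - q * star q = 1) :
    ∃ b, q = p * b ∧ ‖b‖ < 1 := by
  obtain ⟨p, rfl⟩ := hp
  refine ⟨(↑p⁻¹ : B) * q, by simp, ?_⟩
  -- For `b = p⁻¹q` the hypothesis controls `1 - bb*`, so the norm is estimated through `b*`.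
  rw [← norm_star]
  refine norm_lt_one_of_one_sub_star_mul_self_eq (u := star (↑p⁻¹ : B)) p⁻¹.isUnit.star ?_
  have e1 : (↑p⁻¹ : B) * (p : B) = 1 := p.inv_mul
  have e2 : star (p : B) * star (↑p⁻¹ : B) = 1 := by rw [← star_mul, e1, star_one]
  simp only [star_star, star_mul]
  calc 1 - (↑p⁻¹ : B) * q * (star q * star (↑p⁻¹ : B))
      = ((↑p⁻¹ : B) * (p : B)) * (star (p : B) * star (↑p⁻¹ : B))
          - (↑p⁻¹ : B) * q * (star q * star (↑p⁻¹ : B)) := by rw [e1, e2, one_mul]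
    _ = (↑p⁻¹ : B) * (p * star (p : B) - q * star q) * star (↑p⁻¹ : B) := by noncomm_ring
    _ = _ := by rw [h, mul_one]

/-- The two hypotheses supply a left and a right inverse. -/
theorem isUnit_of_isUnit_star_mul_self_of_isUnit_mul_star_self {x : B} (h1 : IsUnit (star x * x))
    (h2 : IsUnit (x * star x)) : IsUnit x := by
  obtain ⟨u, hu⟩ := h1
  obtain ⟨v, hv⟩ := h2
  refine isUnit_iff_exists_and_exists.mpr
    ⟨⟨star x * (↑v⁻¹ : B), ?_⟩, ⟨(↑u⁻¹ : B) * star x, ?_⟩⟩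
  · rw [← mul_assoc, ← hv, v.mul_inv]
  · rw [mul_assoc, ← hu, u.inv_mul]

theorem isClosed_centralizer_operators {K : Type*} [NormedAddCommGroup K] [InnerProductSpace ℂ K]
    [CompleteSpace K] (s : Set (K →L[ℂ] K)) : IsClosed (Set.centralizer s) :=
  Set.isClosed_centralizer s

theorem star_mul_self_sub_of_preserves {R : Type*} [Ring R] [StarRing R] {p q r s : R}
    (h00 : star p * p - star r * r = 1) (h01 : star p * q - star r * s = 0)
    (h10 : star q * p - star s * r = 0) (h11 : star q * q - star s * s = -1) (a : R) :
    star (p + q * a) * (p + q * a) - star (r + s * a) * (r + s * a) = 1 - star a * a := by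
  simp only [star_add, star_mul]
  calc (star p + star a * star q) * (p + q * a) - (star r + star a * star s) * (r + s * a)
      = (star p * p - star r * r) + (star p * q - star r * s) * a
        + star a * (star q * p - star s * r) + star a * (star q * q - star s * s) * a := by
        noncomm_ring
    _ = 1 - star a * a := by
        rw [h00, h01, h10, h11]
        noncomm_ring

end CStar

namespace PoincareDisk

/-! ### Entry relations for `U(θ)` -/

section Entries

variable {A : Type*} [CStarAlgebra A]

theorem star_mul_sub_star_mul_of_mem (g : unitaryTheta A) (i j : Fin 2) :
    star (g.1.1 0 i) * g.1.1 0 j - star (g.1.1 1 i) * g.1.1 1 j =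
      theta (Pi.single i 1) (Pi.single j 1) := by
  simpa [theta, Matrix.mulVec_single_one] using g.2 (Pi.single i 1) (Pi.single j 1)

theorem star_mul_self_zero (g : unitaryTheta A) :
    star (g.1.1 0 0) * g.1.1 0 0 - star (g.1.1 1 0) * g.1.1 1 0 = 1 := by
  simpa [theta] using star_mul_sub_star_mul_of_mem g 0 0

theorem star_mul_zero_one (g : unitaryTheta A) :
    star (g.1.1 0 0) * g.1.1 0 1 - star (g.1.1 1 0) * g.1.1 1 1 = 0 := by
  simpa [theta] using star_mul_sub_star_mul_of_mem g 0 1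

theorem star_mul_one_zero (g : unitaryTheta A) :
    star (g.1.1 0 1) * g.1.1 0 0 - star (g.1.1 1 1) * g.1.1 1 0 = 0 := by
  simpa [theta] using star_mul_sub_star_mul_of_mem g 1 0

theorem star_mul_self_one (g : unitaryTheta A) :
    star (g.1.1 0 1) * g.1.1 0 1 - star (g.1.1 1 1) * g.1.1 1 1 = -1 := by
  simpa [theta] using star_mul_sub_star_mul_of_mem g 1 1

theorem mul_star_self_zero (g : unitaryTheta A) :
    g.1.1 0 0 * star (g.1.1 0 0) - g.1.1 0 1 * star (g.1.1 0 1) = 1 := by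
  -- This matrix is `Jg*J`; a left inverse of the unit `g` is also its right inverse.
  have h : !![star (g.1.1 0 0), -star (g.1.1 1 0); -star (g.1.1 0 1), star (g.1.1 1 1)] * g.1.1
      = 1 := by
    ext i j
    fin_cases i <;> fin_cases j <;> simp [Matrix.mul_apply, Fin.sum_univ_two]
    · simpa [sub_eq_add_neg] using star_mul_self_zero g
    · simpa [sub_eq_add_neg] using star_mul_zero_one g
    · rw [← neg_eq_zero]
      simpa [sub_eq_add_neg, add_comm] using star_mul_one_zero g
    · rw [← neg_inj]
      simpa [sub_eq_add_neg, add_comm] using star_mul_self_one g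
  have h2 := congrFun (congrFun (g.1.mul_eq_one_iff_inv_eq.mpr (g.1.inv_eq_of_mul_eq_one_left h)) 0) 0
  simpa [Matrix.mul_apply, Fin.sum_univ_two, sub_eq_add_neg] using h2

theorem isUnit_apply_zero_zero (g : unitaryTheta A) : IsUnit (g.1.1 0 0) := by
  refine isUnit_of_isUnit_star_mul_self_of_isUnit_mul_star_self ?_ ?_
  · rw [sub_eq_iff_eq_add.mp (star_mul_self_zero g)]
    exact isUnit_one_add_star_mul_self _
  · rw [sub_eq_iff_eq_add.mp (mul_star_self_zero g)]
    simpa using isUnit_one_add_star_mul_self (star (g.1.1 0 1))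

end Entries

/-! ### Linear fractional action on the border -/

section Mobius

variable {A : Type*} [CStarAlgebra A] [PartialOrder A] [StarOrderedRing A]

instance isClosed_bidual :
    IsClosed ((envelopingVonNeumannAlgebra A).toStarSubalgebra :
      Set (UniversalSpace A →L[ℂ] UniversalSpace A)) :=
  isClosed_centralizer_operators _

noncomputable instance : CStarAlgebra (Bidual A) :=
  StarSubalgebra.cstarAlgebra _ (h_closed := isClosed_bidual)

theorem isUnit_mobiusDen (g : unitaryTheta A) {a : Bidual A} (ha : ‖a‖ ≤ 1) :
    IsUnit (mobiusDen g a) := by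
  obtain ⟨b, hb, hb1⟩ := exists_eq_mul_norm_lt_one (isUnit_apply_zero_zero g)
    (mul_star_self_zero g)
  have hlt : ‖-(toBidual A b * a)‖ < 1 := by
    rw [norm_neg]
    calc ‖toBidual A b * a‖ ≤ ‖toBidual A b‖ * ‖a‖ := norm_mul_le _ _
      _ ≤ ‖toBidual A b‖ * 1 := by gcongr
      _ ≤ ‖b‖ := by simpa using NonUnitalStarAlgHom.norm_apply_le (toBidual A) b
      _ < 1 := hb1
  have e : mobiusDen g a = toBidual A (g.1.1 0 0) * (1 - -(toBidual A b * a)) := by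
    rw [mobiusDen, hb, map_mul]
    noncomm_ring
  rw [e]
  exact ((isUnit_apply_zero_zero g).map (toBidual A)).mul (isUnit_one_sub_of_norm_lt_one hlt)

theorem mobiusDen_star_mul_self_sub (g : unitaryTheta A) (a : Bidual A) :
    star (mobiusDen g a) * mobiusDen g a - star (mobiusNum g a) * mobiusNum g a =
      1 - star a * a := by
  have h00 := congrArg (toBidual A) (star_mul_self_zero g)
  have h01 := congrArg (toBidual A) (star_mul_zero_one g)
  have h10 := congrArg (toBidual A) (star_mul_one_zero g)
  have h11 := congrArg (toBidual A) (star_mul_self_one g)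
  rw [map_sub, map_mul, map_mul, map_star, map_star] at h00 h01 h10 h11
  rw [map_one] at h00
  rw [map_zero] at h01 h10
  rw [map_neg, map_one] at h11
  exact star_mul_self_sub_of_preserves h00 h01 h10 h11 a

theorem mobius_mem_border (g : unitaryTheta A) {a : Bidual A} (ha : a ∈ border A) :
    mobiusNum g a * Ring.inverse (mobiusDen g a) ∈ border A := by
  obtain ⟨D, hD⟩ := isUnit_mobiusDen g (le_of_eq ha)
  have h := mobiusDen_star_mul_self_sub g a
  rw [← hD] at h ⊢
  rw [Ring.inverse_unit]
  exact norm_mul_inv_eq_one D h ha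

/-- Cocycle rule: `h` sends `(1, a)` to `(1, h·a)` times the denominator on the right, and `g` acts
from the left. -/
theorem mobiusDen_mul (g h : unitaryTheta A) {a : Bidual A} (ha : IsUnit (mobiusDen h a)) :
    mobiusDen (g * h) a =
      mobiusDen g (mobiusNum h a * Ring.inverse (mobiusDen h a)) * mobiusDen h a := by
  have e := Ring.inverse_mul_cancel _ ha
  have e' : mobiusDen g (mobiusNum h a * Ring.inverse (mobiusDen h a)) * mobiusDen h a =
      toBidual A (g.1.1 0 0) * mobiusDen h a + toBidual A (g.1.1 0 1) * mobiusNum h a := by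
    rw [mobiusDen, add_mul, mul_assoc, mul_assoc, e, mul_one]
  rw [e']
  simp only [mobiusDen, mobiusNum, Subgroup.coe_mul, Units.val_mul, Matrix.mul_apply,
    Fin.sum_univ_two, map_add, map_mul]
  noncomm_ring

theorem mobiusNum_mul (g h : unitaryTheta A) {a : Bidual A} (ha : IsUnit (mobiusDen h a)) :
    mobiusNum (g * h) a =
      mobiusNum g (mobiusNum h a * Ring.inverse (mobiusDen h a)) * mobiusDen h a := by
  have e := Ring.inverse_mul_cancel _ ha
  have e' : mobiusNum g (mobiusNum h a * Ring.inverse (mobiusDen h a)) * mobiusDen h a =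
      toBidual A (g.1.1 1 0) * mobiusDen h a + toBidual A (g.1.1 1 1) * mobiusNum h a := by
    rw [mobiusNum, add_mul, mul_assoc, mul_assoc, e, mul_one]
  rw [e']
  simp only [mobiusDen, mobiusNum, Subgroup.coe_mul, Units.val_mul, Matrix.mul_apply,
    Fin.sum_univ_two, map_add, map_mul]
  noncomm_ring

theorem mobius_one (a : Bidual A) :
    mobiusNum (1 : unitaryTheta A) a * Ring.inverse (mobiusDen (1 : unitaryTheta A) a) = a := by
  simp [mobiusNum, mobiusDen]

theorem mobius_mul (g h : unitaryTheta A) {a : Bidual A} (ha : a ∈ border A) :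
    mobiusNum (g * h) a * Ring.inverse (mobiusDen (g * h) a) =
      mobiusNum g (mobiusNum h a * Ring.inverse (mobiusDen h a)) *
        Ring.inverse (mobiusDen g (mobiusNum h a * Ring.inverse (mobiusDen h a))) := by
  have hh := isUnit_mobiusDen h (le_of_eq ha)
  have hg := isUnit_mobiusDen g (le_of_eq (mobius_mem_border h ha))
  rw [mobiusNum_mul g h hh, mobiusDen_mul g h hh]
  generalize mobiusNum g _ = N
  generalize mobiusDen g _ = D at *
  obtain ⟨D, rfl⟩ := hg
  obtain ⟨E, hE⟩ := hh
  -- The common right factor cancels: `(NE)(DE)⁻¹ = ND⁻¹`.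
  rw [← hE, ← Units.val_mul, Ring.inverse_unit, Ring.inverse_unit, mul_inv_rev, Units.val_mul,
    mul_assoc, Units.mul_inv_cancel_left]

/-- The action of `U(θ)` on the strong border by linear fractional transformations. -/
noncomputable abbrev borderMulAction : MulAction (unitaryTheta A) (border A) where
  smul g a := ⟨mobiusNum g a.1 * Ring.inverse (mobiusDen g a.1), mobius_mem_border g a.2⟩
  one_smul a := Subtype.ext (mobius_one a.1)
  mul_smul g h a := Subtype.ext (mobius_mul g h a.2)

end Mobius

end PoincareDisk

theorem proposition7 {A : Type*} [CStarAlgebra A] [PartialOrder A] [StarOrderedRing A] :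
    (∀ (g : unitaryTheta A) (a : Bidual A), a ∈ border A → IsUnit (mobiusDen g a)) ∧
    (∀ (g : unitaryTheta A) (a : Bidual A), a ∈ border A →
      mobiusNum g a * Ring.inverse (mobiusDen g a) ∈ border A) ∧
    ∃ _ : MulAction (unitaryTheta A) (border A), ∀ (g : unitaryTheta A) (a : border A),
      ((g • a : border A) : Bidual A) =
        mobiusNum g (a : Bidual A) * Ring.inverse (mobiusDen g (a : Bidual A)) := by
  exact ⟨fun g _ ha => isUnit_mobiusDen g (le_of_eq ha), fun g _ ha => mobius_mem_border g ha,
    borderMulAction, fun _ _ => rfl⟩
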